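/- Let $n$ be a natural number, $0\le\alpha<\pi/2$, and let $A,B$ be complex $n\times n$ matrices whose numerical ranges lie in the sector $S_\alpha=\{z\in\mathbb C:\operatorname{Re}z>0,\ |\operatorname{Im}z|\le\tan(\alpha)\operatorname{Re}z\}$. Let $q\in\mathbb C$ with $|q|\le1$ and let $0<t<1$. For a complex $n\times n$ matrix $T$ let $$w_q(T)=\sup\{|\langle Tx,y\rangle| : x,y\in\mathbb C^n,\ \|x\|=\|y\|=1,\ \langle x,y\rangle=q\}$$ be its $q$-numerical radius (with $\sup\emptyset=0$). Put $$A\# B=\Big(\frac2\pi\int_0^\infty(sA+s^{-1}B)^{-1}\frac{ds}s\Big)^{-1},\qquad A\#_tB=\frac{\sin(t\pi)}{\pi}\int_0^\infty s^{t-1}(A^{-1}+sB^{-1})^{-1}\,ds,$$ $$\mathcal H_t(A,B)=\frac{A\#_tB+A\#_{1-t}B}2,\qquad A\Delta B=\frac{A+B}2,$$ the geometric, weighted geometric, Heinz and arithmetic means. Then $$|q|^2\cos^4(\alpha)\,w_q(A\# B)\le|q|\,w_q(\mathcal H_t(A,B))\le\sec^4(\alpha)\,w_q(A\Delta B).$$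 -/

import Mathlib

noncomputable section

namespace QNumRadius

/-- The action of a matrix on the Euclidean space `ℂⁿ`. -/
abbrev op {n : ℕ} (T : Matrix (Fin n) (Fin n) ℂ) :
    EuclideanSpace ℂ (Fin n) →L[ℂ] EuclideanSpace ℂ (Fin n) :=
  Matrix.toEuclideanCLM (n := Fin n) (𝕜 := ℂ) T

/-- The numerical range `W(T) = {⟨T x, x⟩ : ‖x‖ = 1}`. Mathlib's inner product is linear in the
second variable, so `⟨u, v⟩` (linear in `u`) is `inner ℂ v u`. -/
def numericalRange {n : ℕ} (T : Matrix (Fin n) (Fin n) ℂ) : Set ℂ :=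
  {z | ∃ x : EuclideanSpace ℂ (Fin n), ‖x‖ = 1 ∧ z = inner ℂ x (op T x)}

/-- The `q`-numerical range `W_q(T) = {⟨T x, y⟩ : ‖x‖ = ‖y‖ = 1, ⟨x, y⟩ = q}`. -/
def qNumericalRange {n : ℕ} (q : ℂ) (T : Matrix (Fin n) (Fin n) ℂ) : Set ℂ :=
  {z | ∃ x y : EuclideanSpace ℂ (Fin n),
    ‖x‖ = 1 ∧ ‖y‖ = 1 ∧ inner ℂ y x = q ∧ z = inner ℂ y (op T x)}

/-- The `q`-numerical radius `w_q(T) = sup {|z| : z ∈ W_q(T)}` (the supremum of a bounded set of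
reals; it is `0` if that set is empty, which happens only for `n = 0`, or `n = 1` and `|q| < 1`,
when `|q| ≤ 1`). -/
def qNumericalRadius {n : ℕ} (q : ℂ) (T : Matrix (Fin n) (Fin n) ℂ) : ℝ :=
  sSup ((fun z : ℂ => ‖z‖) '' qNumericalRange q T)

/-- The sector `S_α = {z : Re z > 0, |Im z| ≤ tan α · Re z}`. -/
def sector (α : ℝ) : Set ℂ :=
  {z | 0 < z.re ∧ |z.im| ≤ Real.tan α * z.re}

/-- The class of `n × n` matrices whose numerical range lies in the sector `S_α`. -/
def sectorialMatrices (n : ℕ) (α : ℝ) : Set (Matrix (Fin n) (Fin n) ℂ) :=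
  {T | numericalRange T ⊆ sector α}

/-- The geometric mean of accretive matrices,
`A # B = ((2/π) ∫₀^∞ (s A + s⁻¹ B)⁻¹ ds/s)⁻¹`; the integral of a matrix-valued function is
taken entry by entry. -/
def geomMean {n : ℕ} (A B : Matrix (Fin n) (Fin n) ℂ) : Matrix (Fin n) (Fin n) ℂ :=
  (((2 / Real.pi : ℝ) : ℂ) • Matrix.of fun i j =>
    ∫ s in Set.Ioi (0 : ℝ), ((s : ℂ)⁻¹ • ((s : ℂ) • A + (s : ℂ)⁻¹ • B)⁻¹) i j)⁻¹

/-- The weighted geometric mean of accretive matrices,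
`A #_t B = (sin(tπ)/π) ∫₀^∞ s^(t-1) (A⁻¹ + s B⁻¹)⁻¹ ds` for `0 < t < 1`. -/
def weightedGeomMean {n : ℕ} (t : ℝ) (A B : Matrix (Fin n) (Fin n) ℂ) :
    Matrix (Fin n) (Fin n) ℂ :=
  ((Real.sin (t * Real.pi) / Real.pi : ℝ) : ℂ) • Matrix.of fun i j =>
    ∫ s in Set.Ioi (0 : ℝ), (((s ^ (t - 1) : ℝ) : ℂ) • (A⁻¹ + (s : ℂ) • B⁻¹)⁻¹) i j

/-- The Heinz mean `H_t(A, B) = (A #_t B + A #_{1-t} B) / 2`. -/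
def heinzMean {n : ℕ} (t : ℝ) (A B : Matrix (Fin n) (Fin n) ℂ) : Matrix (Fin n) (Fin n) ℂ :=
  (1 / 2 : ℂ) • (weightedGeomMean t A B + weightedGeomMean (1 - t) A B)

/-- The arithmetic mean `A ∆ B = (A + B) / 2`. -/
def arithMean {n : ℕ} (A B : Matrix (Fin n) (Fin n) ℂ) : Matrix (Fin n) (Fin n) ℂ :=
  (1 / 2 : ℂ) • (A + B)

end QNumRadius

end

noncomputable section

namespace QNumRadius

open Matrix MeasureTheory Set
open scoped ComplexOrder

/-! The theorem reduces to scalar inequalities between means. Put `c = tan α`, so `1 + c² = sec² α`.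
Since `Re A` and `Re B` are positive definite, one congruence `S` turns them into `1` and `diag d`
(`exists_simultaneous_diagonal`), and real parts of forms can be compared with weighted sums of
squares of `S x`.

For a sectorial `T`, inversion respects real parts up to one constant: `(1 + c²)⁻¹ (Re T)⁻¹ ≤ Re T⁻¹
≤ (Re T)⁻¹` (`le_re_form_inv`, `re_form_inv_le`). Integrating these bounds, `Re (A # B)` is at most
`1 + c²` times the weight `√d`, while the real part of the Heinz mean lies between the weight `(d^t
+ d^(1-t))/2` and `1 + c²` times it. The arithmetic mean has weight `(1 + d)/2` exactly. The scalar
chain `√d ≤ (d^t + d^(1-t))/2 ≤ (1 + d)/2` then gives `Re X ≤ (1 + c²) Re Y` for both pairs of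
means.

`norm_mul_qNumericalRadius_le` passes from real parts to `w_q`. It combines the sectorial
Cauchy-Schwarz inequality `|⟨X x, y⟩|² ≤ (1 + c²) Re⟨X x, x⟩ Re⟨X y, y⟩` with `|q| |⟨Y x, x⟩| ≤
w_q(Y)`. -/

/-- The sesquilinear form `(x, y) ↦ x* T y` of a matrix. -/
def form {n : ℕ} (T : Matrix (Fin n) (Fin n) ℂ) (x y : Fin n → ℂ) : ℂ :=
  star x ⬝ᵥ T *ᵥ y

/-- The weighted sum of squares `∑ i, f i * |x i|²`. -/
def wsq {n : ℕ} (f : Fin n → ℝ) (x : Fin n → ℂ) : ℝ :=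
  ∑ i, f i * ‖x i‖ ^ 2

variable {n : ℕ}

/-! ### Algebra of forms and weighted sums of squares -/

lemma form_add_left (T : Matrix (Fin n) (Fin n) ℂ) (x y z : Fin n → ℂ) :
    form T (x + y) z = form T x z + form T y z := by
  simp [form, add_dotProduct]

lemma form_add_right (T : Matrix (Fin n) (Fin n) ℂ) (x y z : Fin n → ℂ) :
    form T x (y + z) = form T x y + form T x z := by
  simp [form, mulVec_add]

lemma form_smul_left (T : Matrix (Fin n) (Fin n) ℂ) (a : ℂ) (x y : Fin n → ℂ) :
    form T (a • x) y = star a * form T x y := by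
  simp [form]

lemma form_smul_right (T : Matrix (Fin n) (Fin n) ℂ) (a : ℂ) (x y : Fin n → ℂ) :
    form T x (a • y) = a * form T x y := by
  simp [form, mulVec_smul]

lemma add_form (S T : Matrix (Fin n) (Fin n) ℂ) (x y : Fin n → ℂ) :
    form (S + T) x y = form S x y + form T x y := by
  simp [form, add_mulVec]

lemma sub_form (S T : Matrix (Fin n) (Fin n) ℂ) (x y : Fin n → ℂ) :
    form (S - T) x y = form S x y - form T x y := by
  simp [form, sub_mulVec]

lemma smul_form (a : ℂ) (T : Matrix (Fin n) (Fin n) ℂ) (x y : Fin n → ℂ) :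
    form (a • T) x y = a * form T x y := by
  simp [form, smul_mulVec]

lemma form_conjTranspose (T : Matrix (Fin n) (Fin n) ℂ) (x y : Fin n → ℂ) :
    form Tᴴ x y = star (form T y x) := by
  simp only [form]
  rw [star_dotProduct, star_mulVec, ← dotProduct_mulVec, conjTranspose_conjTranspose]

lemma form_congruence (T V W : Matrix (Fin n) (Fin n) ℂ) (x y : Fin n → ℂ) :
    form (Vᴴ * T * W) x y = form T (V *ᵥ x) (W *ᵥ y) := by
  simp only [form]
  rw [star_mulVec, ← dotProduct_mulVec, mulVec_mulVec, mulVec_mulVec, Matrix.mul_assoc]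

lemma form_diagonal (f : Fin n → ℝ) (x : Fin n → ℂ) :
    form (diagonal fun i => (f i : ℂ)) x x = wsq f x := by
  simp only [form, wsq, dotProduct, mulVec_diagonal, Pi.star_apply, RCLike.star_def]
  push_cast
  refine Finset.sum_congr rfl fun i _ => ?_
  rw [← Complex.conj_mul']
  ring

lemma form_one (x : Fin n → ℂ) : form 1 x x = wsq 1 x := by
  rw [← form_diagonal]
  simp

lemma wsq_diagonal_mulVec (f g : Fin n → ℝ) (x : Fin n → ℂ) :
    wsq f ((diagonal fun i => (g i : ℂ)) *ᵥ x) = wsq (fun i => f i * g i ^ 2) x := by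
  simp only [wsq, mulVec_diagonal, norm_mul, mul_pow, Complex.norm_real, Real.norm_eq_abs, sq_abs]
  exact Finset.sum_congr rfl fun i _ => by ring

lemma wsq_nonneg {f : Fin n → ℝ} (hf : ∀ i, 0 ≤ f i) (x : Fin n → ℂ) : 0 ≤ wsq f x :=
  Finset.sum_nonneg fun i _ => mul_nonneg (hf i) (by positivity)

lemma wsq_mono {f g : Fin n → ℝ} (h : ∀ i, f i ≤ g i) (x : Fin n → ℂ) : wsq f x ≤ wsq g x :=
  Finset.sum_le_sum fun i _ => mul_le_mul_of_nonneg_right (h i) (by positivity)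

lemma wsq_pos {f : Fin n → ℝ} (hf : ∀ i, 0 < f i) {x : Fin n → ℂ} (hx : x ≠ 0) : 0 < wsq f x := by
  obtain ⟨i, hi⟩ := Function.ne_iff.1 hx
  refine Finset.sum_pos' (fun i _ => mul_nonneg (hf i).le (by positivity))
    ⟨i, Finset.mem_univ _, mul_pos (hf i) ?_⟩
  have : 0 < ‖x i‖ := norm_pos_iff.2 hi
  positivity

lemma wsq_const_mul (a : ℝ) (f : Fin n → ℝ) (x : Fin n → ℂ) :
    wsq (fun i => a * f i) x = a * wsq f x := by
  simp [wsq, Finset.mul_sum, mul_assoc]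

lemma wsq_add (f g : Fin n → ℝ) (x : Fin n → ℂ) :
    wsq (fun i => f i + g i) x = wsq f x + wsq g x := by
  simp [wsq, add_mul, Finset.sum_add_distrib]

lemma norm_dotProduct_sq_le (x y : Fin n → ℂ) :
    ‖star x ⬝ᵥ y‖ ^ 2 ≤ wsq 1 x * wsq 1 y := by
  have h1 : ‖star x ⬝ᵥ y‖ ≤ ∑ i, ‖x i‖ * ‖y i‖ := by
    refine (norm_sum_le _ _).trans_eq (Finset.sum_congr rfl fun i _ => by simp)
  calc ‖star x ⬝ᵥ y‖ ^ 2 ≤ (∑ i, ‖x i‖ * ‖y i‖) ^ 2 := by gcongr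
    _ ≤ _ := by simpa [wsq] using Finset.sum_mul_sq_le_sq_mul_sq Finset.univ (‖x ·‖) (‖y ·‖)

/-! ### Cauchy-Schwarz for sectorial forms -/

/-- If `T` has real part `1` and its form lies in the sector of slope `c`, then
`‖T x‖² ≤ (1 + c²) ‖x‖²`. -/
lemma wsq_mulVec_le_of_re_eq_one {T : Matrix (Fin n) (Fin n) ℂ} {c : ℝ} (hc : 0 ≤ c)
    (h : ∀ x, (form T x x).re = wsq 1 x) (hs : ∀ x, |(form T x x).im| ≤ c * (form T x x).re)
    (x : Fin n → ℂ) : wsq 1 (T *ᵥ x) ≤ (1 + c ^ 2) * wsq 1 x := by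
  -- `K` is the skew-Hermitian part of `T`. The lemma amounts to `‖K x‖ ≤ c ‖x‖` together with
  -- Pythagoras, as `Re⟨K x, x⟩ = 0`.
  set K := T - 1 with hK
  have hKre : ∀ x, (form K x x).re = 0 := fun x => by
    rw [hK, sub_form, form_one, Complex.sub_re, h, Complex.ofReal_re, sub_self]
  have hKim : ∀ x, |(form K x x).im| ≤ c * wsq 1 x := fun x => by
    rw [hK, sub_form, form_one, Complex.sub_im, Complex.ofReal_im, sub_zero, ← h]
    exact hs x
  set v := K *ᵥ x with hv
  have hTx : T *ᵥ x = x + v := by rw [hv, hK, sub_mulVec, one_mulVec]; abel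
  have hvv : form K v x = wsq 1 v := by rw [← form_one]; simp [form, hv]
  have hxv : (form K x v).re = - wsq 1 v := by
    have := hKre (v + x)
    simp only [form_add_left, form_add_right, Complex.add_re, hKre, hvv, Complex.ofReal_re] at this
    linarith
  have hwadd : ∀ u w : Fin n → ℂ, ((wsq 1 (u + w) : ℝ) : ℂ) =
      wsq 1 u + wsq 1 w + (form 1 u w + form 1 w u) := fun u w => by
    rw [← form_one, ← form_one, ← form_one, form_add_left, form_add_right, form_add_right]; ring
  have hsum : wsq 1 (x + v) = wsq 1 x + wsq 1 v := by
    have h1 : form 1 x v = form K x x := by simp [form, hv]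
    have h2 : form 1 v x = star (form 1 x v) := by
      rw [← form_conjTranspose, conjTranspose_one]
    have := congrArg Complex.re (hwadd x v)
    rw [h2, h1] at this
    simp only [Complex.add_re, Complex.ofReal_re, hKre, RCLike.star_def, Complex.conj_re] at this
    linarith
  have hpar : ∀ u w : Fin n → ℂ, wsq 1 (u + w) + wsq 1 (u + (-1 : ℂ) • w)
      = 2 * (wsq 1 u + wsq 1 w) := fun u w => by
    have h1 := congrArg Complex.re (hwadd u w)
    have h2 := congrArg Complex.re (hwadd u ((-1 : ℂ) • w))
    have h3 : wsq 1 ((-1 : ℂ) • w) = wsq 1 w := by simp [wsq]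
    simp only [form_smul_left, form_smul_right, h3] at h2
    simp at h1 h2 ⊢
    linarith
  -- Polarization: the values of `Im form K` at `v ± i l x` differ by `4 l ‖v‖²`, and the
  -- parallelogram law sums their bounds. The choice `l = c` is optimal; `l = 1` settles `c = 0`.
  have key : ∀ l : ℝ, 4 * l * wsq 1 v ≤ c * (2 * (wsq 1 v + l ^ 2 * wsq 1 x)) := fun l => by
    have e1 := hKim (v + ((l : ℂ) * Complex.I) • x)
    have e2 := hKim (v + (-1 : ℂ) • ((l : ℂ) * Complex.I) • x)
    have e3 := hpar v (((l : ℂ) * Complex.I) • x)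
    have e4 : wsq 1 (((l : ℂ) * Complex.I) • x) = l ^ 2 * wsq 1 x := by
      simp [wsq, Finset.mul_sum, mul_pow]
    rw [e4] at e3
    rw [← e3, mul_add]
    have f1 := (abs_le.1 e1).2
    have f2 := (abs_le.1 e2).1
    simp only [form_add_left, form_add_right, form_smul_left, form_smul_right, hvv] at f1 f2
    simp [hxv, hKre] at f1 f2 ⊢
    linarith
  have hv2 : wsq 1 v ≤ c ^ 2 * wsq 1 x := by
    rcases hc.eq_or_lt with rfl | hc
    · have := key 1
      nlinarith
    · have := key c
      have : c * (wsq 1 v) ≤ c * (c ^ 2 * wsq 1 x) := by nlinarith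
      exact le_of_mul_le_mul_left this hc
  rw [hTx, hsum]
  linarith

/-- Cauchy-Schwarz inequality for a sectorial form, together with the dual bound. -/
lemma wsq_dual_mulVec_le {T V U : Matrix (Fin n) (Fin n) ℂ} {c : ℝ} (hc : 0 ≤ c)
    (hUV : Uᴴ * V = 1) (h : ∀ x, (form T x x).re = wsq 1 (V *ᵥ x))
    (hs : ∀ x, |(form T x x).im| ≤ c * (form T x x).re) (x : Fin n → ℂ) :
    wsq 1 (U *ᵥ T *ᵥ x) ≤ (1 + c ^ 2) * wsq 1 (V *ᵥ x) := by
  have hVU : V * Uᴴ = 1 := mul_eq_one_comm.1 hUV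
  have hf : ∀ x, form (U * T * Uᴴ) x x = form T (Uᴴ *ᵥ x) (Uᴴ *ᵥ x) := fun x => by
    have := form_congruence T Uᴴ Uᴴ x x
    rwa [conjTranspose_conjTranspose] at this
  -- Since `U` is the inverse of `Vᴴ` and `Re T = Vᴴ V`, the congruent matrix `U T Uᴴ` has real part
  -- `1`; it is evaluated at `V x`.
  have := wsq_mulVec_le_of_re_eq_one (T := U * T * Uᴴ) hc
    (fun x => by rw [hf, h, mulVec_mulVec, hVU, one_mulVec])
    (fun x => by rw [hf]; exact hs _) (V *ᵥ x)
  rwa [mulVec_mulVec, Matrix.mul_assoc, hUV, Matrix.mul_one, ← mulVec_mulVec] at this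

/-- Because `Vᴴ U = 1`, the form is the ordinary inner product of `V x` and `U T y`, and the dual
bound controls the second vector. -/
lemma norm_form_sq_le {T V U : Matrix (Fin n) (Fin n) ℂ} {c : ℝ} (hc : 0 ≤ c)
    (hUV : Uᴴ * V = 1) (h : ∀ x, (form T x x).re = wsq 1 (V *ᵥ x))
    (hs : ∀ x, |(form T x x).im| ≤ c * (form T x x).re) (x y : Fin n → ℂ) :
    ‖form T x y‖ ^ 2 ≤ (1 + c ^ 2) * ((form T x x).re * (form T y y).re) := by
  have h1 : form T x y = star (V *ᵥ x) ⬝ᵥ (U *ᵥ T *ᵥ y) := by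
    have h2 : Vᴴ * U = 1 := by simpa using congrArg conjTranspose hUV
    rw [form, star_mulVec, ← dotProduct_mulVec, mulVec_mulVec, h2, one_mulVec]
  rw [h1, h, h]
  have h2 := norm_dotProduct_sq_le (V *ᵥ x) (U *ᵥ T *ᵥ y)
  have h3 := mul_le_mul_of_nonneg_left (wsq_dual_mulVec_le hc hUV h hs y)
    (wsq_nonneg (f := 1) (fun _ => zero_le_one) (V *ᵥ x))
  linarith

/-! ### Real parts of inverses -/

lemma isUnit_of_re_form_pos {T : Matrix (Fin n) (Fin n) ℂ}
    (h : ∀ x, x ≠ 0 → 0 < (form T x x).re) : IsUnit T := by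
  rw [← mulVec_injective_iff_isUnit]
  intro x y hxy
  by_contra hne
  have h1 := h (x - y) (sub_ne_zero.2 hne)
  have h2 : T *ᵥ (x - y) = 0 := by rw [mulVec_sub, sub_eq_zero]; exact hxy
  simp [form, h2] at h1

lemma mulVec_ne_zero {U V : Matrix (Fin n) (Fin n) ℂ} (hUV : Uᴴ * V = 1) {x : Fin n → ℂ}
    (hx : x ≠ 0) : V *ᵥ x ≠ 0 := fun h => hx <| by
  rw [← one_mulVec x, ← hUV, ← mulVec_mulVec, h, mulVec_zero]

lemma mulVec_inv_mulVec {T : Matrix (Fin n) (Fin n) ℂ} (hT : IsUnit T) (x : Fin n → ℂ) :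
    T *ᵥ T⁻¹ *ᵥ x = x := by
  rw [mulVec_mulVec, mul_nonsing_inv _ ((isUnit_iff_isUnit_det _).1 hT), one_mulVec]

lemma form_inv {T : Matrix (Fin n) (Fin n) ℂ} (hT : IsUnit T) (x : Fin n → ℂ) :
    form T⁻¹ x x = star (form T (T⁻¹ *ᵥ x) (T⁻¹ *ᵥ x)) := by
  rw [← form_conjTranspose, form, form, ← mulVec_inv_mulVec hT x, star_mulVec,
    ← dotProduct_mulVec, mulVec_inv_mulVec hT x]

lemma re_form_inv {T : Matrix (Fin n) (Fin n) ℂ} (hT : IsUnit T) (x : Fin n → ℂ) :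
    (form T⁻¹ x x).re = (form T (T⁻¹ *ᵥ x) (T⁻¹ *ᵥ x)).re := by
  rw [form_inv hT]; simp

lemma inv_mulVec_ne_zero {T : Matrix (Fin n) (Fin n) ℂ} (hT : IsUnit T) {x : Fin n → ℂ}
    (hx : x ≠ 0) : T⁻¹ *ᵥ x ≠ 0 := fun h => hx <| by
  rw [← mulVec_inv_mulVec hT x, h, mulVec_zero]

lemma re_form_inv_pos {T : Matrix (Fin n) (Fin n) ℂ} (h : ∀ x, x ≠ 0 → 0 < (form T x x).re)
    {x : Fin n → ℂ} (hx : x ≠ 0) : 0 < (form T⁻¹ x x).re := by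
  have hT := isUnit_of_re_form_pos h
  rw [re_form_inv hT]
  exact h _ (inv_mulVec_ne_zero hT hx)

lemma abs_im_form_inv_le {T : Matrix (Fin n) (Fin n) ℂ} (hT : IsUnit T) {c : ℝ}
    (hs : ∀ x, |(form T x x).im| ≤ c * (form T x x).re) (x : Fin n → ℂ) :
    |(form T⁻¹ x x).im| ≤ c * (form T⁻¹ x x).re := by
  rw [form_inv hT]
  simpa using hs (T⁻¹ *ᵥ x)

/-- `Re T⁻¹ ≤ M⁻¹` if `Re T ≥ M > 0`. -/
lemma re_form_inv_le {T U V : Matrix (Fin n) (Fin n) ℂ} {f : Fin n → ℝ} (hf : ∀ i, 0 < f i)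
    (hUV : Uᴴ * V = 1) (h : ∀ x, wsq f (V *ᵥ x) ≤ (form T x x).re) (x : Fin n → ℂ) :
    (form T⁻¹ x x).re ≤ wsq (fun i => (f i)⁻¹) (U *ᵥ x) := by
  have hT : IsUnit T := isUnit_of_re_form_pos fun x hx =>
    (wsq_pos hf (mulVec_ne_zero hUV hx)).trans_le (h x)
  set y := T⁻¹ *ᵥ x with hy
  have h1 := h y
  -- Young's inequality in each coordinate. The term `wsq f (V y)` is at most `Re⟨T y, y⟩`, which
  -- equals the left side and is absorbed into it.
  have h2 : (form T⁻¹ x x).re ≤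
      (wsq (fun i => (f i)⁻¹) (U *ᵥ x) + wsq f (V *ᵥ y)) / 2 := by
    have h3 : form T⁻¹ x x = star (U *ᵥ x) ⬝ᵥ V *ᵥ y := by
      rw [star_mulVec, ← dotProduct_mulVec, mulVec_mulVec, hUV, one_mulVec, form]
    rw [h3, wsq, wsq, ← Finset.sum_add_distrib, Finset.sum_div]
    refine (Complex.re_le_norm _).trans ((norm_sum_le _ _).trans (Finset.sum_le_sum fun i _ => ?_))
    have hi := hf i
    rw [norm_mul, Pi.star_apply, norm_star, le_div_iff₀ two_pos, ← sub_nonneg]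
    have : (f i)⁻¹ * ‖(U *ᵥ x) i‖ ^ 2 + f i * ‖(V *ᵥ y) i‖ ^ 2
        - ‖(U *ᵥ x) i‖ * ‖(V *ᵥ y) i‖ * 2
        = (f i)⁻¹ * (‖(U *ᵥ x) i‖ - f i * ‖(V *ᵥ y) i‖) ^ 2 := by
      field_simp
      ring
    rw [this]
    positivity
  rw [re_form_inv hT] at h2 ⊢
  linarith

/-- `Re T⁻¹ ≥ (1 + c²)⁻¹ (Re T)⁻¹` if the form of `T` lies in the sector of slope `c`. -/
lemma le_re_form_inv {T U V : Matrix (Fin n) (Fin n) ℂ} {f : Fin n → ℝ} (hf : ∀ i, 0 < f i)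
    {c : ℝ} (hc : 0 ≤ c) (hUV : Uᴴ * V = 1) (h : ∀ x, (form T x x).re = wsq f (V *ᵥ x))
    (hs : ∀ x, |(form T x x).im| ≤ c * (form T x x).re) (x : Fin n → ℂ) :
    (1 + c ^ 2)⁻¹ * wsq (fun i => (f i)⁻¹) (U *ᵥ x) ≤ (form T⁻¹ x x).re := by
  have hT : IsUnit T := isUnit_of_re_form_pos fun x hx => by
    rw [h]; exact wsq_pos hf (mulVec_ne_zero hUV hx)
  -- Absorbing `√f` into `V` makes the weight `1`, so that the dual bound applies at `T⁻¹ x`.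
  set D : Matrix (Fin n) (Fin n) ℂ := diagonal fun i => (√(f i) : ℂ) with hD
  set D' : Matrix (Fin n) (Fin n) ℂ := diagonal fun i => ((√(f i))⁻¹ : ℝ) with hD'
  have hDD : D'ᴴ * D = 1 := by
    rw [hD, hD', diagonal_conjTranspose, diagonal_mul_diagonal, ← diagonal_one]
    congr 1
    ext i
    have : (√(f i) : ℂ) ≠ 0 := by
      exact_mod_cast (Real.sqrt_pos.2 (hf i)).ne'
    simp [this]
  have hUV' : (D' * U)ᴴ * (D * V) = 1 := by
    rw [conjTranspose_mul, Matrix.mul_assoc, ← Matrix.mul_assoc D'ᴴ, hDD, Matrix.one_mul, hUV]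
  have hV : ∀ x, (form T x x).re = wsq 1 ((D * V) *ᵥ x) := fun x => by
    rw [h, ← mulVec_mulVec, hD, wsq_diagonal_mulVec]
    congr 1
    ext i
    simp [Real.sq_sqrt (hf i).le]
  have := wsq_dual_mulVec_le hc hUV' hV hs (T⁻¹ *ᵥ x)
  rw [mulVec_inv_mulVec hT, ← hV, ← re_form_inv hT, ← mulVec_mulVec, hD',
    wsq_diagonal_mulVec] at this
  have hinv : (fun i => (1 : Fin n → ℝ) i * (√(f i))⁻¹ ^ 2) = fun i => (f i)⁻¹ := by
    ext i
    simp [Real.sq_sqrt (hf i).le]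
  rwa [inv_mul_le_iff₀ (by positivity), ← hinv]

/-! ### Simultaneous diagonalization and parallel sums -/

lemma exists_diagonal_of_posDef {P : Matrix (Fin n) (Fin n) ℂ} (hP : P.PosDef) :
    ∃ (U : Matrix (Fin n) (Fin n) ℂ) (d : Fin n → ℝ), (∀ i, 0 < d i) ∧ Uᴴ * U = 1 ∧
      P = Uᴴ * (diagonal fun i => (d i : ℂ)) * U := by
  refine ⟨star (hP.1.eigenvectorUnitary : Matrix _ _ ℂ), hP.1.eigenvalues, hP.eigenvalues_pos,
    ?_, ?_⟩
  · simp [← star_eq_conjTranspose]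
  · have := hP.1.spectral_theorem
    rw [Unitary.conjStarAlgAut_apply] at this
    rw [← star_eq_conjTranspose, star_star]
    exact this

lemma posDef_half_add_conjTranspose {A : Matrix (Fin n) (Fin n) ℂ}
    (hA : ∀ x, x ≠ 0 → 0 < (form A x x).re) : ((1 / 2 : ℂ) • (A + Aᴴ)).PosDef := by
  refine PosDef.of_dotProduct_mulVec_pos ?_ fun x hx => ?_
  · simp [IsHermitian, conjTranspose_smul, add_comm]
  · change 0 < form _ x x
    rw [smul_form, add_form, form_conjTranspose, RCLike.star_def, Complex.add_conj,
      ← Complex.ofReal_one, ← Complex.ofReal_ofNat, ← Complex.ofReal_div, ← Complex.ofReal_mul]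
    have := hA x hx
    exact_mod_cast (by linarith : 0 < 1 / 2 * (2 * (form A x x).re))

lemma re_form_half_add_conjTranspose (A : Matrix (Fin n) (Fin n) ℂ) (x : Fin n → ℂ) :
    (form ((1 / 2 : ℂ) • (A + Aᴴ)) x x).re = (form A x x).re := by
  rw [smul_form, add_form, form_conjTranspose, RCLike.star_def, Complex.add_conj,
      ← Complex.ofReal_one, ← Complex.ofReal_ofNat, ← Complex.ofReal_div, ← Complex.ofReal_mul,
      Complex.ofReal_re]
  ring

lemma exists_conjTranspose_mul_self_of_posDef {P : Matrix (Fin n) (Fin n) ℂ} (hP : P.PosDef) :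
    ∃ V U : Matrix (Fin n) (Fin n) ℂ, Uᴴ * V = 1 ∧ P = Vᴴ * V := by
  obtain ⟨W, d, hd, hW, rfl⟩ := exists_diagonal_of_posDef hP
  refine ⟨(diagonal fun i => (√(d i) : ℂ)) * W, (diagonal fun i => ((√(d i))⁻¹ : ℂ)) * W, ?_, ?_⟩
  · rw [conjTranspose_mul, Matrix.mul_assoc, ← Matrix.mul_assoc _ _ W, diagonal_conjTranspose,
      diagonal_mul_diagonal]
    convert hW
    convert Matrix.one_mul W
    rw [← diagonal_one]
    congr 1
    ext i
    have : (√(d i) : ℂ) ≠ 0 := by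
      exact_mod_cast (Real.sqrt_pos.2 (hd i)).ne'
    simp [this]
  · rw [conjTranspose_mul, diagonal_conjTranspose, ← Matrix.mul_assoc (Wᴴ * _),
      Matrix.mul_assoc Wᴴ (diagonal (star _)), diagonal_mul_diagonal]
    congr 3
    ext i
    simp only [Pi.star_apply, RCLike.star_def, Complex.conj_ofReal]
    rw [← Complex.ofReal_mul, Real.mul_self_sqrt (hd i).le]

/-- Simultaneous diagonalization by congruence of the real parts of two matrices. -/
lemma exists_simultaneous_diagonal {A B : Matrix (Fin n) (Fin n) ℂ}
    (hA : ∀ x, x ≠ 0 → 0 < (form A x x).re) (hB : ∀ x, x ≠ 0 → 0 < (form B x x).re) :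
    ∃ (S R : Matrix (Fin n) (Fin n) ℂ) (d : Fin n → ℝ), Rᴴ * S = 1 ∧ (∀ i, 0 < d i) ∧
      (∀ x, (form A x x).re = wsq 1 (S *ᵥ x)) ∧ ∀ x, (form B x x).re = wsq d (S *ᵥ x) := by
  obtain ⟨V, U, hUV, hV⟩ :=
    exists_conjTranspose_mul_self_of_posDef (posDef_half_add_conjTranspose hA)
  -- With `Re A = Vᴴ V`, the congruence by `Uᴴ` sends `Re A` to `1`. A unitary `W` diagonalizing the
  -- transformed `Re B` leaves `1` unchanged.
  have hB' : ∀ x, x ≠ 0 → 0 < (form (U * B * Uᴴ) x x).re := fun x hx => by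
    have h1 := form_congruence B Uᴴ Uᴴ x x
    rw [conjTranspose_conjTranspose] at h1
    rw [h1]
    refine hB _ (mulVec_ne_zero (U := Vᴴ) ?_ hx)
    rw [conjTranspose_conjTranspose]
    exact mul_eq_one_comm.1 hUV
  obtain ⟨W, d, hd, hW, hWB⟩ := exists_diagonal_of_posDef (posDef_half_add_conjTranspose hB')
  refine ⟨W * V, W * U, d, ?_, hd, fun x => ?_, fun x => ?_⟩
  · rw [conjTranspose_mul, Matrix.mul_assoc, ← Matrix.mul_assoc _ W, hW, Matrix.one_mul, hUV]
  · rw [← re_form_half_add_conjTranspose, hV]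
    have h1 : Vᴴ * V = (W * V)ᴴ * 1 * (W * V) := by
      rw [conjTranspose_mul, Matrix.mul_one, Matrix.mul_assoc, ← Matrix.mul_assoc _ W, hW,
        Matrix.one_mul]
    rw [h1, form_congruence, form_one, Complex.ofReal_re]
  · have h1 : B = Vᴴ * (U * B * Uᴴ) * V := by
      have h2 : Vᴴ * U = 1 := by simpa using congrArg conjTranspose hUV
      rw [Matrix.mul_assoc, Matrix.mul_assoc _ Uᴴ, hUV, Matrix.mul_one, ← Matrix.mul_assoc, h2,
        Matrix.one_mul]
    conv_lhs => rw [h1]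
    rw [form_congruence, ← re_form_half_add_conjTranspose, hWB, form_congruence, form_diagonal,
      Complex.ofReal_re, mulVec_mulVec]

/-- The real part of a parallel sum dominates the parallel sum of the real parts. -/
lemma le_re_form_parallel_sum {A B S R : Matrix (Fin n) (Fin n) ℂ} {d : Fin n → ℝ}
    (hRS : Rᴴ * S = 1) (hd : ∀ i, 0 < d i)
    (hA : ∀ x, (form A x x).re = wsq 1 (S *ᵥ x)) (hB : ∀ x, (form B x x).re = wsq d (S *ᵥ x))
    {s : ℝ} (hs : 0 < s) (x : Fin n → ℂ) :
    wsq (fun i => (1 + s / d i)⁻¹) (S *ᵥ x) ≤ (form (A⁻¹ + (s : ℂ) • B⁻¹)⁻¹ x x).re := by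
  have hA0 : ∀ x, x ≠ 0 → 0 < (form A x x).re := fun x hx => by
    rw [hA]; exact wsq_pos (fun _ => one_pos) (mulVec_ne_zero hRS hx)
  have hB0 : ∀ x, x ≠ 0 → 0 < (form B x x).re := fun x hx => by
    rw [hB]; exact wsq_pos hd (mulVec_ne_zero hRS hx)
  have hT : IsUnit (A⁻¹ + (s : ℂ) • B⁻¹) := isUnit_of_re_form_pos fun x hx => by
    rw [add_form, smul_form, Complex.add_re, Complex.re_ofReal_mul]
    have := re_form_inv_pos hA0 hx
    have := re_form_inv_pos hB0 hx
    positivity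
  set u := (A⁻¹ + (s : ℂ) • B⁻¹)⁻¹ *ᵥ x with hu
  set y := A⁻¹ *ᵥ u with hy
  set z := B⁻¹ *ᵥ u with hz
  -- The form equals the energy `Re⟨A y, y⟩ + s Re⟨B z, z⟩` of this splitting of `x`. Every
  -- splitting costs at least the diagonal parallel sum, so no sector constant is lost.
  have hyz : x = y + (s : ℂ) • z := by
    rw [← mulVec_inv_mulVec hT x, ← hu, add_mulVec, smul_mulVec]
  have h1 : (form (A⁻¹ + (s : ℂ) • B⁻¹)⁻¹ x x).re = wsq 1 (S *ᵥ y) + s * wsq d (S *ᵥ z) := by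
    rw [re_form_inv hT, ← hu, add_form, smul_form, Complex.add_re, Complex.re_ofReal_mul,
      re_form_inv (isUnit_of_re_form_pos hA0), re_form_inv (isUnit_of_re_form_pos hB0), hA, hB]
  rw [h1, hyz, mulVec_add, mulVec_smul, wsq, wsq, wsq, Finset.mul_sum, ← Finset.sum_add_distrib]
  refine Finset.sum_le_sum fun i _ => ?_
  set a := (S *ᵥ y) i
  set b := (S *ᵥ z) i
  have hi := hd i
  have h2 : ‖(S *ᵥ y + (s : ℂ) • S *ᵥ z) i‖ ≤ ‖a‖ + s * ‖b‖ := by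
    refine (norm_add_le _ _).trans_eq ?_
    simp [a, b, abs_of_pos hs]
  have h3 : ‖(S *ᵥ y + (s : ℂ) • S *ᵥ z) i‖ ^ 2 ≤ (‖a‖ + s * ‖b‖) ^ 2 := by gcongr
  rw [inv_mul_le_iff₀ (by positivity)]
  refine h3.trans (sub_nonneg.1 ?_)
  have h4 : (1 + s / d i) * ((1 : Fin n → ℝ) i * ‖a‖ ^ 2 + s * (d i * ‖b‖ ^ 2))
      - (‖a‖ + s * ‖b‖) ^ 2 = s / d i * (‖a‖ - d i * ‖b‖) ^ 2 := by
    simp only [Pi.one_apply]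
    field_simp
    ring
  rw [h4]
  positivity

/-! ### Scalar integrals -/

lemma image_div_one_add_Ioi : (fun s : ℝ => s / (1 + s)) '' Ioi 0 = Ioo 0 1 := by
  ext x
  constructor
  · rintro ⟨s, hs, rfl⟩
    have hs : 0 < s := hs
    exact ⟨by positivity, (div_lt_one (by positivity)).2 (by linarith)⟩
  · rintro ⟨h0, h1⟩
    have h1' : 0 < 1 - x := by linarith
    refine ⟨x / (1 - x), div_pos h0 h1', ?_⟩
    simp only
    field_simp
    ring

/-- This is the Beta integral `B(t, 1 - t) = Γ(t) Γ(1 - t)`, evaluated by the reflection formula. -/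
lemma integral_rpow_mul_one_sub_rpow {t : ℝ} (ht₀ : 0 < t) (ht₁ : t < 1) :
    ∫ x in Ioo (0 : ℝ) 1, x ^ (t - 1) * (1 - x) ^ (-t) = Real.pi / Real.sin (t * Real.pi) := by
  have h1 : Complex.betaIntegral t (1 - t : ℝ) =
      ((∫ x in Ioo (0 : ℝ) 1, x ^ (t - 1) * (1 - x) ^ (-t) : ℝ) : ℂ) := by
    rw [Complex.betaIntegral, intervalIntegral.integral_of_le zero_le_one,
      integral_Ioc_eq_integral_Ioo, ← integral_complex_ofReal]
    refine setIntegral_congr_fun measurableSet_Ioo fun x hx => ?_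
    have hx' : (0 : ℝ) ≤ 1 - x := by linarith [hx.2]
    rw [Complex.ofReal_mul, Complex.ofReal_cpow hx.1.le, Complex.ofReal_cpow hx']
    push_cast
    congr 2
    ring
  have h2 := ProbabilityTheory.beta_eq_betaIntegralReal t (1 - t) ht₀ (by linarith)
  rw [h1, Complex.ofReal_re, ProbabilityTheory.beta, Real.Gamma_mul_Gamma_one_sub] at h2
  rw [← h2, add_sub_cancel, Real.Gamma_one, div_one, mul_comm t]

lemma integral_rpow_mul_inv_one_add {t : ℝ} (ht₀ : 0 < t) (ht₁ : t < 1) :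
    ∫ s in Ioi (0 : ℝ), s ^ (t - 1) * (1 + s)⁻¹ = Real.pi / Real.sin (t * Real.pi) := by
  rw [← integral_rpow_mul_one_sub_rpow ht₀ ht₁, ← image_div_one_add_Ioi,
    integral_image_eq_integral_abs_deriv_smul (f' := fun s => 1 / (1 + s) ^ 2) measurableSet_Ioi]
  · refine setIntegral_congr_fun measurableSet_Ioi fun s hs => ?_
    have hs : 0 < s := hs
    have h1 : 0 < 1 + s := by positivity
    have h2 : 1 - s / (1 + s) = (1 + s)⁻¹ := by field_simp; ring
    simp only [smul_eq_mul]
    rw [abs_of_pos (by positivity), h2, Real.div_rpow hs.le h1.le, Real.inv_rpow h1.le,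
      Real.rpow_neg h1.le, inv_inv, Real.rpow_sub_one h1.ne']
    have : 0 < (1 + s) ^ t := Real.rpow_pos_of_pos h1 t
    field_simp
  · intro s hs
    have hs : 0 < s := hs
    have h1 : 1 + s ≠ 0 := by positivity
    have h2 := ((hasDerivAt_id s).div ((hasDerivAt_id s).const_add 1) h1).hasDerivWithinAt
      (s := Ioi 0)
    have h3 : (1 * (1 + id s) - id s * 1) / (1 + id s) ^ 2 = 1 / (1 + s) ^ 2 := by simp
    rw [h3] at h2
    exact h2
  · intro a ha b hb hab
    have ha : 0 < a := ha
    have hb : 0 < b := hb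
    simp only at hab
    field_simp at hab
    linarith

lemma integral_rpow_mul_inv_one_add_div {t : ℝ} (ht₀ : 0 < t) (ht₁ : t < 1) {d : ℝ} (hd : 0 < d) :
    ∫ s in Ioi (0 : ℝ), s ^ (t - 1) * (1 + s / d)⁻¹ =
      d ^ t * (Real.pi / Real.sin (t * Real.pi)) := by
  have h := integral_comp_mul_left_Ioi' (fun s : ℝ => s ^ (t - 1) * (1 + s / d)⁻¹) 0 hd
  rw [mul_zero] at h
  rw [← h, ← integral_rpow_mul_inv_one_add ht₀ ht₁, smul_eq_mul, ← integral_const_mul,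
    ← integral_const_mul]
  refine setIntegral_congr_fun measurableSet_Ioi fun s hs => ?_
  have hs : 0 < s := hs
  rw [Real.mul_rpow hd.le hs.le, mul_div_cancel_left₀ _ hd.ne', Real.rpow_sub_one hd.ne']
  field_simp

lemma sin_mul_pi_pos {t : ℝ} (ht₀ : 0 < t) (ht₁ : t < 1) : 0 < Real.sin (t * Real.pi) :=
  Real.sin_pos_of_pos_of_lt_pi (by positivity) (by nlinarith [Real.pi_pos])

/-- The integral of a non-integrable function is `0` by convention, while the value computed above
is positive. -/
lemma integrableOn_rpow_mul_inv_one_add_div {t : ℝ} (ht₀ : 0 < t) (ht₁ : t < 1) {d : ℝ}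
    (hd : 0 < d) : IntegrableOn (fun s : ℝ => s ^ (t - 1) * (1 + s / d)⁻¹) (Ioi 0) := by
  by_contra h
  have h1 := integral_rpow_mul_inv_one_add_div ht₀ ht₁ hd
  rw [integral_undef h] at h1
  have := sin_mul_pi_pos ht₀ ht₁
  have := Real.pi_pos
  have := Real.rpow_pos_of_pos hd t
  exact absurd h1 (by positivity)

lemma integral_inv_sq_add {d : ℝ} (hd : 0 < d) :
    ∫ s in Ioi (0 : ℝ), (s ^ 2 + d)⁻¹ = (√d)⁻¹ * (Real.pi / 2) := by
  have hd' := Real.sqrt_pos.2 hd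
  have h := integral_comp_mul_left_Ioi' (fun s : ℝ => (s ^ 2 + d)⁻¹) 0 hd'
  have h2 : ∫ s in Ioi (0 : ℝ), (1 + s ^ 2)⁻¹ = Real.pi / 2 := by simp
  rw [mul_zero] at h
  rw [← h, ← h2, smul_eq_mul, ← integral_const_mul, ← integral_const_mul]
  refine setIntegral_congr_fun measurableSet_Ioi fun s hs => ?_
  rw [mul_pow, Real.sq_sqrt hd.le]
  have h3 : d * s ^ 2 + d = √d * √d * (1 + s ^ 2) := by rw [Real.mul_self_sqrt hd.le]; ring
  rw [h3]
  field_simp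

lemma integrableOn_inv_sq_add {d : ℝ} (hd : 0 < d) :
    IntegrableOn (fun s : ℝ => (s ^ 2 + d)⁻¹) (Ioi 0) := by
  by_contra h
  have h1 := integral_inv_sq_add hd
  rw [integral_undef h] at h1
  have := Real.sqrt_pos.2 hd
  have := Real.pi_pos
  exact absurd h1 (by positivity)

/-! ### Entrywise integrals of matrix functions -/

lemma form_eq_sum (T : Matrix (Fin n) (Fin n) ℂ) (x y : Fin n → ℂ) :
    form T x y = ∑ i, ∑ j, star (x i) * (T i j * y j) := by
  simp [form, dotProduct, mulVec, Finset.mul_sum]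

lemma form_single (T : Matrix (Fin n) (Fin n) ℂ) (i j : Fin n) :
    form T (Pi.single i 1) (Pi.single j 1) = T i j := by
  simp [form]

/-- The integral over `(0, ∞)`, entry by entry, of a matrix-valued function. -/
def matIntegral (F : ℝ → Matrix (Fin n) (Fin n) ℂ) : Matrix (Fin n) (Fin n) ℂ :=
  Matrix.of fun i j => ∫ s in Ioi (0 : ℝ), F s i j

lemma integrableOn_form {F : ℝ → Matrix (Fin n) (Fin n) ℂ}
    (hF : ∀ i j, IntegrableOn (fun s => F s i j) (Ioi 0)) (x y : Fin n → ℂ) :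
    IntegrableOn (fun s => form (F s) x y) (Ioi 0) := by
  simp only [form_eq_sum]
  exact integrable_finsetSum _ fun i _ => integrable_finsetSum _ fun j _ =>
    ((hF i j).mul_const _).const_mul _

lemma form_matIntegral {F : ℝ → Matrix (Fin n) (Fin n) ℂ}
    (hF : ∀ i j, IntegrableOn (fun s => F s i j) (Ioi 0)) (x y : Fin n → ℂ) :
    form (matIntegral F) x y = ∫ s in Ioi (0 : ℝ), form (F s) x y := by
  simp only [form_eq_sum]
  rw [integral_finsetSum _ fun i _ => integrable_finsetSum _ fun j _ =>
    ((hF i j).mul_const _).const_mul _]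
  refine Finset.sum_congr rfl fun i _ => ?_
  rw [integral_finsetSum _ fun j _ => ((hF i j).mul_const _).const_mul _]
  refine Finset.sum_congr rfl fun j _ => ?_
  rw [integral_const_mul, integral_mul_const]
  rfl

lemma re_form_matIntegral {F : ℝ → Matrix (Fin n) (Fin n) ℂ}
    (hF : ∀ i j, IntegrableOn (fun s => F s i j) (Ioi 0)) (x y : Fin n → ℂ) :
    (form (matIntegral F) x y).re = ∫ s in Ioi (0 : ℝ), (form (F s) x y).re := by
  rw [form_matIntegral hF]
  exact (integral_re (integrableOn_form hF x y)).symm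

lemma im_form_matIntegral {F : ℝ → Matrix (Fin n) (Fin n) ℂ}
    (hF : ∀ i j, IntegrableOn (fun s => F s i j) (Ioi 0)) (x y : Fin n → ℂ) :
    (form (matIntegral F) x y).im = ∫ s in Ioi (0 : ℝ), (form (F s) x y).im := by
  rw [form_matIntegral hF]
  exact (integral_im (integrableOn_form hF x y)).symm

lemma abs_im_form_matIntegral_le {F : ℝ → Matrix (Fin n) (Fin n) ℂ}
    (hF : ∀ i j, IntegrableOn (fun s => F s i j) (Ioi 0)) {c : ℝ}
    (hs : ∀ s > 0, ∀ x, |(form (F s) x x).im| ≤ c * (form (F s) x x).re) (x : Fin n → ℂ) :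
    |(form (matIntegral F) x x).im| ≤ c * (form (matIntegral F) x x).re := by
  rw [re_form_matIntegral hF, im_form_matIntegral hF, ← integral_const_mul]
  refine (abs_integral_le_integral_abs).trans (setIntegral_mono_on ?_ ?_ measurableSet_Ioi
    fun s hs0 => hs s hs0 x)
  · exact (integrableOn_form hF x x).im.abs
  · exact (integrableOn_form hF x x).re.const_mul c

lemma integrableOn_wsq {φ : Fin n → ℝ → ℝ} (hφ : ∀ i, IntegrableOn (φ i) (Ioi 0))
    (x : Fin n → ℂ) : IntegrableOn (fun s => wsq (fun i => φ i s) x) (Ioi 0) :=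
  integrable_finsetSum _ fun i _ => (hφ i).mul_const _

lemma integral_wsq {φ : Fin n → ℝ → ℝ} (hφ : ∀ i, IntegrableOn (φ i) (Ioi 0))
    (x : Fin n → ℂ) : ∫ s in Ioi (0 : ℝ), wsq (fun i => φ i s) x =
      wsq (fun i => ∫ s in Ioi (0 : ℝ), φ i s) x := by
  simp only [wsq]
  rw [integral_finsetSum _ fun i _ => (hφ i).mul_const _]
  exact Finset.sum_congr rfl fun i _ => integral_mul_const _ _

lemma wsq_le_re_form_matIntegral {F : ℝ → Matrix (Fin n) (Fin n) ℂ}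
    (hF : ∀ i j, IntegrableOn (fun s => F s i j) (Ioi 0)) {φ : Fin n → ℝ → ℝ}
    (hφ : ∀ i, IntegrableOn (φ i) (Ioi 0)) {W : Matrix (Fin n) (Fin n) ℂ}
    (h : ∀ s > 0, ∀ x, wsq (fun i => φ i s) (W *ᵥ x) ≤ (form (F s) x x).re) (x : Fin n → ℂ) :
    wsq (fun i => ∫ s in Ioi (0 : ℝ), φ i s) (W *ᵥ x) ≤ (form (matIntegral F) x x).re := by
  rw [re_form_matIntegral hF, ← integral_wsq hφ]
  exact setIntegral_mono_on (integrableOn_wsq hφ _) (integrableOn_form hF x x).re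
    measurableSet_Ioi fun s hs => h s hs x

lemma re_form_matIntegral_le_wsq {F : ℝ → Matrix (Fin n) (Fin n) ℂ}
    (hF : ∀ i j, IntegrableOn (fun s => F s i j) (Ioi 0)) {φ : Fin n → ℝ → ℝ}
    (hφ : ∀ i, IntegrableOn (φ i) (Ioi 0)) {W : Matrix (Fin n) (Fin n) ℂ}
    (h : ∀ s > 0, ∀ x, (form (F s) x x).re ≤ wsq (fun i => φ i s) (W *ᵥ x)) (x : Fin n → ℂ) :
    (form (matIntegral F) x x).re ≤ wsq (fun i => ∫ s in Ioi (0 : ℝ), φ i s) (W *ᵥ x) := by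
  rw [re_form_matIntegral hF, ← integral_wsq hφ]
  exact setIntegral_mono_on (integrableOn_form hF x x).re (integrableOn_wsq hφ _)
    measurableSet_Ioi fun s hs => h s hs x

/-- Cauchy-Schwarz for sectorial matrices with strictly positive real part. -/
lemma norm_form_le_of_sectorial {T : Matrix (Fin n) (Fin n) ℂ} {c : ℝ} (hc : 0 ≤ c)
    (hT : ∀ x, x ≠ 0 → 0 < (form T x x).re)
    (hs : ∀ x, |(form T x x).im| ≤ c * (form T x x).re) (x y : Fin n → ℂ) :
    ‖form T x y‖ ^ 2 ≤ (1 + c ^ 2) * ((form T x x).re * (form T y y).re) := by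
  obtain ⟨S, R, d, hRS, -, h, -⟩ := exists_simultaneous_diagonal hT hT
  exact norm_form_sq_le hc hRS h hs x y

/-- An entry is the form at two basis vectors, so Cauchy-Schwarz dominates it by diagonal real
parts, which the integrable weights `φ` control. -/
lemma integrableOn_of_sectorial {F : ℝ → Matrix (Fin n) (Fin n) ℂ} {c : ℝ} (hc : 0 ≤ c)
    (hm : ∀ i j, AEStronglyMeasurable (fun s => F s i j) (volume.restrict (Ioi 0)))
    (hpos : ∀ s > 0, ∀ x, x ≠ 0 → 0 < (form (F s) x x).re)
    (hs : ∀ s > 0, ∀ x, |(form (F s) x x).im| ≤ c * (form (F s) x x).re)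
    {φ : Fin n → ℝ → ℝ} (hφ : ∀ i, IntegrableOn (φ i) (Ioi 0)) {W : Matrix (Fin n) (Fin n) ℂ}
    (h : ∀ s > 0, ∀ x, (form (F s) x x).re ≤ wsq (fun i => φ i s) (W *ᵥ x)) (i j : Fin n) :
    IntegrableOn (fun s => F s i j) (Ioi 0) := by
  set e : Fin n → Fin n → ℂ := fun i => Pi.single i 1
  have he : ∀ i, e i ≠ 0 := fun i => by simp [e]
  refine Integrable.mono' (((integrableOn_wsq hφ (W *ᵥ e i)).add
    (integrableOn_wsq hφ (W *ᵥ e j))).const_mul (1 + c ^ 2)) (hm i j) ?_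
  filter_upwards [ae_restrict_mem measurableSet_Ioi] with s hs0
  have hs0 : 0 < s := hs0
  have h1 := norm_form_le_of_sectorial hc (hpos s hs0) (hs s hs0) (e i) (e j)
  rw [form_single] at h1
  have hi := h s hs0 (e i)
  have hj := h s hs0 (e j)
  have hi' := hpos s hs0 (e i) (he i)
  have hj' := hpos s hs0 (e j) (he j)
  set a := (form (F s) (e i) (e i)).re
  set b := (form (F s) (e j) (e j)).re
  have h2 : ‖F s i j‖ ≤ (1 + c ^ 2) * (a + b) := by
    refine abs_le_of_sq_le_sq' ?_ (by positivity) |>.2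
    refine h1.trans ?_
    -- Deliberately crude bounds: both factors become squares, so the root can be taken at once.
    have h3 : (1 + c ^ 2) ≤ (1 + c ^ 2) ^ 2 := by nlinarith [sq_nonneg c, sq_nonneg (c ^ 2)]
    have h4 : a * b ≤ (a + b) ^ 2 := by nlinarith
    rw [mul_pow]
    exact mul_le_mul h3 h4 (by positivity) (by positivity)
  refine h2.trans ?_
  simp only [Pi.add_apply]
  gcongr

/-! ### Sectorial matrices and their numerical range -/

/-- The form of `T` takes values in the sector of slope `c`, with positive real part away
from `0`. -/
structure IsSectorial (c : ℝ) (T : Matrix (Fin n) (Fin n) ℂ) : Prop where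
  re_pos : ∀ x, x ≠ 0 → 0 < (form T x x).re
  abs_im_le : ∀ x, |(form T x x).im| ≤ c * (form T x x).re

namespace IsSectorial

variable {c : ℝ} {A B : Matrix (Fin n) (Fin n) ℂ}

lemma isUnit (hA : IsSectorial c A) : IsUnit A :=
  isUnit_of_re_form_pos hA.re_pos

lemma add (hA : IsSectorial c A) (hB : IsSectorial c B) : IsSectorial c (A + B) where
  re_pos x hx := by
    rw [add_form, Complex.add_re]
    exact add_pos (hA.re_pos x hx) (hB.re_pos x hx)
  abs_im_le x := by
    rw [add_form, Complex.add_re, Complex.add_im, mul_add]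
    exact (abs_add_le _ _).trans (add_le_add (hA.abs_im_le x) (hB.abs_im_le x))

lemma smul (hA : IsSectorial c A) {r : ℝ} (hr : 0 < r) : IsSectorial c ((r : ℂ) • A) where
  re_pos x hx := by
    rw [smul_form, Complex.re_ofReal_mul]
    exact mul_pos hr (hA.re_pos x hx)
  abs_im_le x := by
    rw [smul_form, Complex.re_ofReal_mul, Complex.im_ofReal_mul, abs_mul, abs_of_pos hr]
    have := mul_le_mul_of_nonneg_left (hA.abs_im_le x) hr.le
    linarith

lemma inv (hA : IsSectorial c A) : IsSectorial c A⁻¹ where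
  re_pos _ hx := re_form_inv_pos hA.re_pos hx
  abs_im_le := abs_im_form_inv_le hA.isUnit hA.abs_im_le

end IsSectorial

lemma inner_op (T : Matrix (Fin n) (Fin n) ℂ) (x y : EuclideanSpace ℂ (Fin n)) :
    inner ℂ y (op T x) = form T y.ofLp x.ofLp := by
  rw [EuclideanSpace.inner_eq_star_dotProduct, dotProduct_comm]
  rfl

lemma isSectorial_of_mem {α : ℝ} {T : Matrix (Fin n) (Fin n) ℂ}
    (hT : T ∈ sectorialMatrices n α) : IsSectorial (Real.tan α) T := by
  have key : ∀ x : Fin n → ℂ, x ≠ 0 → ∃ r : ℝ, 0 < r ∧ ∃ z ∈ sector α, form T x x = r * z := by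
    intro x hx
    set u : EuclideanSpace ℂ (Fin n) := WithLp.toLp 2 x
    have hu : 0 < ‖u‖ := norm_pos_iff.2 fun h => hx (by simpa [u] using h)
    refine ⟨‖u‖ ^ 2, by positivity, _, hT ⟨((‖u‖⁻¹ : ℝ) : ℂ) • u, ?_, rfl⟩, ?_⟩
    · rw [norm_smul, Complex.norm_real, norm_inv, norm_norm, inv_mul_cancel₀ hu.ne']
    · rw [inner_op, WithLp.ofLp_smul, form_smul_left, form_smul_right]
      have : (‖u‖ : ℂ) ≠ 0 := by exact_mod_cast hu.ne'
      simp only [RCLike.star_def, Complex.conj_ofReal]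
      push_cast
      field_simp
      rfl
  refine ⟨fun x hx => ?_, fun x => ?_⟩
  · obtain ⟨r, hr, z, hz, h⟩ := key x hx
    rw [h, Complex.re_ofReal_mul]
    exact mul_pos hr hz.1
  · rcases eq_or_ne x 0 with rfl | hx
    · simp [form]
    · obtain ⟨r, hr, z, hz, h⟩ := key x hx
      rw [h, Complex.re_ofReal_mul, Complex.im_ofReal_mul, abs_mul, abs_of_pos hr]
      have := mul_le_mul_of_nonneg_left hz.2 hr.le
      linarith

/-! ### Comparison of `q`-numerical radii -/

lemma bddAbove_norm_qNumericalRange (q : ℂ) (T : Matrix (Fin n) (Fin n) ℂ) :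
    BddAbove ((fun z : ℂ => ‖z‖) '' qNumericalRange q T) := by
  refine ⟨‖op T‖, ?_⟩
  rintro _ ⟨_, ⟨x, y, hx, hy, -, rfl⟩, rfl⟩
  have h1 := norm_inner_le_norm (𝕜 := ℂ) y (op T x)
  have h2 := (op T).le_opNorm x
  rw [hx, mul_one] at h2
  rw [hy, one_mul] at h1
  exact h1.trans h2

/-- Supplies the component orthogonal to `x` of a unit vector whose inner product with `x` is
prescribed. If nothing nonzero is orthogonal to `x`, the space is a line, the given inner product
has modulus `1`, and `z = 0` works. -/
lemma exists_orthogonal_norm_sq_eq {E : Type*} [NormedAddCommGroup E] [InnerProductSpace ℂ E]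
    {x x₀ y₀ : E} (hx : ‖x‖ = 1) (hx₀ : ‖x₀‖ = 1) (hy₀ : ‖y₀‖ = 1)
    (hq : ‖(inner ℂ y₀ x₀ : ℂ)‖ ≤ 1) :
    ∃ z : E, inner ℂ x z = 0 ∧ ‖z‖ ^ 2 = 1 - ‖(inner ℂ y₀ x₀ : ℂ)‖ ^ 2 := by
  by_cases h : ∃ z : E, z ≠ 0 ∧ inner ℂ x z = 0
  · obtain ⟨z, hz, hxz⟩ := h
    refine ⟨((√(1 - ‖(inner ℂ y₀ x₀ : ℂ)‖ ^ 2) * ‖z‖⁻¹ : ℝ) : ℂ) • z, ?_, ?_⟩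
    · rw [inner_smul_right, hxz, mul_zero]
    · have hz' := norm_ne_zero_iff.2 hz
      rw [norm_smul, Complex.norm_real, mul_pow, Real.norm_eq_abs, sq_abs, mul_pow, Real.sq_sqrt]
      · field_simp
      · nlinarith [norm_nonneg (inner ℂ y₀ x₀ : ℂ)]
  · push Not at h
    have hu : ∀ u : E, u = (inner ℂ x u : ℂ) • x := fun u => by
      by_contra hne
      refine h (u - (inner ℂ x u : ℂ) • x) (sub_ne_zero.2 hne) ?_
      rw [inner_sub_right, inner_smul_right, inner_self_eq_norm_sq_to_K, hx]
      simp
    have hnorm : ∀ u : E, ‖u‖ = 1 → ‖(inner ℂ x u : ℂ)‖ = 1 := fun u h1 => by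
      have h2 := congrArg norm (hu u)
      rwa [norm_smul, hx, mul_one, h1, eq_comm] at h2
    refine ⟨0, inner_zero_right _, ?_⟩
    have h1 : ‖(inner ℂ y₀ x₀ : ℂ)‖ = 1 := by
      conv_lhs => rw [hu y₀]
      rw [inner_smul_left, norm_mul, RCLike.norm_conj, hnorm _ hx₀, hnorm _ hy₀, mul_one]
    rw [h1]
    simp

/-- `|q| |⟨T x, x⟩| ≤ w_q(T)` for every unit vector `x`, if `W_q(T)` is not empty. -/
lemma norm_mul_norm_form_le_qNumericalRadius {q : ℂ} (hq : ‖q‖ ≤ 1)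
    (T : Matrix (Fin n) (Fin n) ℂ) {x x₀ y₀ : EuclideanSpace ℂ (Fin n)} (hx : ‖x‖ = 1)
    (hx₀ : ‖x₀‖ = 1) (hy₀ : ‖y₀‖ = 1) (h₀ : inner ℂ y₀ x₀ = q) :
    ‖q‖ * ‖form T x.ofLp x.ofLp‖ ≤ qNumericalRadius q T := by
  obtain ⟨z, hxz, hz⟩ := exists_orthogonal_norm_sq_eq hx hx₀ hy₀ (by rwa [h₀])
  rw [h₀] at hz
  have hzx : inner ℂ z x = 0 := inner_eq_zero_symm.1 hxz
  -- The partner of `x` is `y = q̄ x + e z`. Averaging over `e = ±1` cancels the cross term and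
  -- leaves `q ⟨T x, x⟩`.
  have key : ∀ e : ℂ, ‖e‖ = 1 →
      ‖q * form T x.ofLp x.ofLp + star e * inner ℂ z (op T x)‖ ≤ qNumericalRadius q T := by
    intro e he
    refine le_csSup (bddAbove_norm_qNumericalRange q T)
      ⟨_, ⟨x, star q • x + e • z, hx, ?_, ?_, rfl⟩, ?_⟩
    · have h1 : inner ℂ (star q • x) (e • z) = 0 := by
        rw [inner_smul_left, inner_smul_right, hxz]; simp
      have h2 := norm_add_sq_eq_norm_sq_add_norm_sq_of_inner_eq_zero _ _ h1
      rw [norm_smul, norm_smul, hx, he, norm_star, one_mul, mul_one, ← sq, ← sq, ← sq, hz] at h2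
      have h3 : ‖star q • x + e • z‖ ^ 2 = 1 := by rw [h2]; ring
      exact (pow_eq_one_iff_of_nonneg (norm_nonneg _) two_ne_zero).1 h3
    · rw [inner_add_left, inner_smul_left, inner_smul_left, hzx, inner_self_eq_norm_sq_to_K, hx]
      simp
    · rw [inner_add_left, inner_smul_left, inner_smul_left, inner_op]
      simp
  have h1 := key 1 (by simp)
  have h2 := key (-1) (by simp)
  have h3 := norm_add_le (q * form T x.ofLp x.ofLp + star 1 * inner ℂ z (op T x))
    (q * form T x.ofLp x.ofLp + star (-1) * inner ℂ z (op T x))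
  have h4 : (q * form T x.ofLp x.ofLp + star 1 * inner ℂ z (op T x)) +
    (q * form T x.ofLp x.ofLp + star (-1) * inner ℂ z (op T x)) =
      2 * (q * form T x.ofLp x.ofLp) := by simp; ring
  rw [h4, norm_mul, norm_mul, Complex.norm_ofNat] at h3
  linarith

lemma qNumericalRadius_nonneg (q : ℂ) (T : Matrix (Fin n) (Fin n) ℂ) :
    0 ≤ qNumericalRadius q T :=
  Real.sSup_nonneg (by rintro _ ⟨z, -, rfl⟩; exact norm_nonneg z)

/-- Comparison of the `q`-numerical radii of `X` and `Y` if `X` is sectorial and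
`Re X ≤ (1 + c²) Re Y`. -/
lemma norm_mul_qNumericalRadius_le {c : ℝ} (hc : 0 ≤ c) {q : ℂ} (hq : ‖q‖ ≤ 1)
    {X Y : Matrix (Fin n) (Fin n) ℂ} (hX : IsSectorial c X)
    (h : ∀ x, (form X x x).re ≤ (1 + c ^ 2) * (form Y x x).re) :
    ‖q‖ * qNumericalRadius q X ≤ (1 + c ^ 2) ^ 2 * qNumericalRadius q Y := by
  have hY := qNumericalRadius_nonneg q Y
  rw [qNumericalRadius, ← smul_eq_mul, ← Real.sSup_smul_of_nonneg (norm_nonneg q)]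
  -- An empty range is covered by the default value `0`; otherwise its pair `x, y` witnesses that
  -- `W_q(Y)` is nonempty.
  refine Real.sSup_le ?_ (by positivity)
  rintro _ ⟨_, ⟨_, ⟨x, y, hx, hy, hxy, rfl⟩, rfl⟩, rfl⟩
  simp only [smul_eq_mul]
  rw [inner_op]
  have hre : ∀ u : EuclideanSpace ℂ (Fin n), ‖u‖ = 1 → 0 ≤ ‖q‖ * (form X u.ofLp u.ofLp).re ∧
      ‖q‖ * (form X u.ofLp u.ofLp).re ≤ (1 + c ^ 2) * qNumericalRadius q Y := fun u hu => by
    constructor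
    · refine mul_nonneg (norm_nonneg q) ?_
      rcases eq_or_ne u.ofLp 0 with h0 | h0
      · simp [h0, form]
      · exact (hX.re_pos _ h0).le
    · calc ‖q‖ * (form X u.ofLp u.ofLp).re
          ≤ ‖q‖ * ((1 + c ^ 2) * ‖form Y u.ofLp u.ofLp‖) := by
            refine mul_le_mul_of_nonneg_left ((h _).trans ?_) (norm_nonneg q)
            exact mul_le_mul_of_nonneg_left (Complex.re_le_norm _) (by positivity)
        _ = (1 + c ^ 2) * (‖q‖ * ‖form Y u.ofLp u.ofLp‖) := by ring
        _ ≤ _ := mul_le_mul_of_nonneg_left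
            (norm_mul_norm_form_le_qNumericalRadius hq Y hu hx hy hxy) (by positivity)
  obtain ⟨hx1, hx2⟩ := hre x hx
  obtain ⟨hy1, hy2⟩ := hre y hy
  have h1 := norm_form_le_of_sectorial hc hX.re_pos hX.abs_im_le y.ofLp x.ofLp
  refine abs_le_of_sq_le_sq' ?_ (by positivity) |>.2
  have h2 := mul_le_mul_of_nonneg_left h1 (sq_nonneg ‖q‖)
  have h3 := mul_le_mul_of_nonneg_left (mul_le_mul hy2 hx2 hx1 (hy1.trans hy2))
    (by positivity : 0 ≤ 1 + c ^ 2)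
  -- The squared estimate only needs the third power: one factor from Cauchy-Schwarz, one from each
  -- real part. It is relaxed to the fourth.
  have h4 : (1 + c ^ 2) ^ 3 ≤ (1 + c ^ 2) ^ 4 :=
    pow_le_pow_right₀ (by nlinarith [sq_nonneg c]) (by norm_num)
  have h5 := mul_le_mul_of_nonneg_right h4 (sq_nonneg (qNumericalRadius q Y))
  calc _ = ‖q‖ ^ 2 * ‖form X y.ofLp x.ofLp‖ ^ 2 := by ring
    _ ≤ _ := h2
    _ = (1 + c ^ 2) * (‖q‖ * (form X y.ofLp y.ofLp).re * (‖q‖ * (form X x.ofLp x.ofLp).re)) := by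
      ring
    _ ≤ _ := h3
    _ = (1 + c ^ 2) ^ 3 * qNumericalRadius q Y ^ 2 := by ring
    _ ≤ _ := h5
    _ = _ := by ring

/-! ### Real-part bounds for the means -/

/-- By Cramer's rule the entries of the inverse are continuous wherever the determinant does not
vanish. -/
lemma aestronglyMeasurable_smul_inv {M : ℝ → Matrix (Fin n) (Fin n) ℂ}
    (hM : ContinuousOn M (Ioi 0)) (hU : ∀ s > 0, IsUnit (M s)) {g : ℝ → ℂ}
    (hg : ContinuousOn g (Ioi 0)) (i j : Fin n) :
    AEStronglyMeasurable (fun s => (g s • (M s)⁻¹) i j) (volume.restrict (Ioi 0)) := by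
  refine ContinuousOn.aestronglyMeasurable ?_ measurableSet_Ioi
  simp only [Matrix.inv_def, Ring.inverse_eq_inv', Matrix.smul_apply, smul_eq_mul]
  have h1 : ContinuousOn (fun s => (M s).det) (Ioi 0) :=
    (continuous_id.matrix_det).comp_continuousOn hM
  have h2 : ContinuousOn (fun s => (M s).adjugate i j) (Ioi 0) :=
    ((continuous_id.matrix_adjugate).matrix_elem i j).comp_continuousOn hM
  exact hg.mul ((h1.inv₀ fun s hs => ((isUnit_iff_isUnit_det _).1 (hU s hs)).ne_zero).mul h2)

variable {c : ℝ} {A B S R : Matrix (Fin n) (Fin n) ℂ} {d : Fin n → ℝ}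

lemma re_form_smul_add_smul (hA' : ∀ x, (form A x x).re = wsq 1 (S *ᵥ x))
    (hB' : ∀ x, (form B x x).re = wsq d (S *ᵥ x)) (a b : ℝ) (x : Fin n → ℂ) :
    (form ((a : ℂ) • A + (b : ℂ) • B) x x).re = wsq (fun i => a + b * d i) (S *ᵥ x) := by
  rw [add_form, smul_form, smul_form, Complex.add_re, Complex.re_ofReal_mul,
    Complex.re_ofReal_mul, hA', hB', wsq_add, wsq_const_mul]
  congr 1
  rw [← wsq_const_mul]
  simp

lemma geomMean_eq (A B : Matrix (Fin n) (Fin n) ℂ) :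
    geomMean A B = (((2 / Real.pi : ℝ) : ℂ) • matIntegral fun s =>
      ((s⁻¹ : ℝ) : ℂ) • ((s : ℂ) • A + ((s⁻¹ : ℝ) : ℂ) • B)⁻¹)⁻¹ := by
  simp only [Complex.ofReal_inv]
  rfl

/-- The real part of `s A + s⁻¹ B` is exactly diagonal in the coordinates `S x`. Its inversion costs
`1 + c²` in the lower bound; the outer inversion turns this into an upper bound at no further cost.
-/
lemma geomMean_bounds (hc : 0 ≤ c) (hA : IsSectorial c A) (hB : IsSectorial c B)
    (hRS : Rᴴ * S = 1) (hd : ∀ i, 0 < d i) (hA' : ∀ x, (form A x x).re = wsq 1 (S *ᵥ x))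
    (hB' : ∀ x, (form B x x).re = wsq d (S *ᵥ x)) :
    IsSectorial c (geomMean A B) ∧
      ∀ x, (form (geomMean A B) x x).re ≤ (1 + c ^ 2) * wsq (fun i => √(d i)) (S *ᵥ x) := by
  set T : ℝ → Matrix (Fin n) (Fin n) ℂ := fun s => (s : ℂ) • A + ((s⁻¹ : ℝ) : ℂ) • B with hT
  set F : ℝ → Matrix (Fin n) (Fin n) ℂ := fun s => ((s⁻¹ : ℝ) : ℂ) • (T s)⁻¹ with hF
  have hTs : ∀ s > 0, IsSectorial c (T s) := fun s hs =>
    (hA.smul hs).add (hB.smul (inv_pos.2 hs))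
  have hFs : ∀ s > 0, IsSectorial c (F s) := fun s hs => (hTs s hs).inv.smul (inv_pos.2 hs)
  have hw : ∀ s > 0, ∀ i, 0 < s + s⁻¹ * d i := fun s hs i => by
    have := hd i
    positivity
  have hφ : ∀ s > 0, (fun i => s⁻¹ * (s + s⁻¹ * d i)⁻¹) = fun i => (s ^ 2 + d i)⁻¹ :=
    fun s hs => by
      ext i
      have := hd i
      field_simp
  -- This upper bound serves only to prove integrability.
  have hup : ∀ s > 0, ∀ x, (form (F s) x x).re ≤ wsq (fun i => (s ^ 2 + d i)⁻¹) (R *ᵥ x) :=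
    fun s hs x => by
      rw [← hφ s hs, wsq_const_mul, hF, smul_form, Complex.re_ofReal_mul]
      exact mul_le_mul_of_nonneg_left (re_form_inv_le (hw s hs) hRS
        (fun x => (re_form_smul_add_smul hA' hB' _ _ x).ge) x) (inv_pos.2 hs).le
  have hlow : ∀ s > 0, ∀ x,
      wsq (fun i => (1 + c ^ 2)⁻¹ * (s ^ 2 + d i)⁻¹) (R *ᵥ x) ≤ (form (F s) x x).re :=
    fun s hs x => by
      rw [wsq_const_mul, ← hφ s hs, wsq_const_mul, hF, smul_form, Complex.re_ofReal_mul]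
      have := mul_le_mul_of_nonneg_left (le_re_form_inv (hw s hs) hc hRS
        (fun x => re_form_smul_add_smul hA' hB' _ _ x) (hTs s hs).abs_im_le x) (inv_pos.2 hs).le
      linarith
  have hinv : ContinuousOn (fun s : ℝ => ((s⁻¹ : ℝ) : ℂ)) (Ioi 0) :=
    Complex.continuous_ofReal.comp_continuousOn
      (continuousOn_id.inv₀ fun s (hs : 0 < s) => hs.ne')
  have hint : ∀ i j, IntegrableOn (fun s => F s i j) (Ioi 0) :=
    integrableOn_of_sectorial hc
      (aestronglyMeasurable_smul_inv
        ((Complex.continuous_ofReal.continuousOn.smul continuousOn_const).add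
          (hinv.smul continuousOn_const)) (fun s hs => (hTs s hs).isUnit) hinv)
      (fun s hs => (hFs s hs).re_pos) (fun s hs => (hFs s hs).abs_im_le)
      (fun i => integrableOn_inv_sq_add (hd i)) hup
  have hGlow : ∀ x, wsq (fun i => ((1 + c ^ 2) * √(d i))⁻¹) (R *ᵥ x) ≤
      (form (((2 / Real.pi : ℝ) : ℂ) • matIntegral F) x x).re := fun x => by
    have h1 := wsq_le_re_form_matIntegral hint
      (fun i => (integrableOn_inv_sq_add (hd i)).const_mul (1 + c ^ 2)⁻¹) hlow x
    rw [smul_form, Complex.re_ofReal_mul]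
    refine le_trans (le_of_eq ?_) (mul_le_mul_of_nonneg_left h1 (by positivity))
    rw [← wsq_const_mul]
    congr 1
    ext i
    rw [integral_const_mul, integral_inv_sq_add (hd i)]
    have := Real.sqrt_pos.2 (hd i)
    field_simp
  have hf : ∀ i, 0 < ((1 + c ^ 2) * √(d i))⁻¹ := fun i => by
    have := Real.sqrt_pos.2 (hd i)
    positivity
  have hGpos : ∀ x, x ≠ 0 → 0 < (form (((2 / Real.pi : ℝ) : ℂ) • matIntegral F) x x).re :=
    fun x hx => (wsq_pos hf (mulVec_ne_zero (U := S)
      (by simpa using congrArg conjTranspose hRS) hx)).trans_le (hGlow x)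
  have hG : IsSectorial c (((2 / Real.pi : ℝ) : ℂ) • matIntegral F) := by
    refine ⟨hGpos, fun x => ?_⟩
    have h1 := abs_im_form_matIntegral_le hint (fun s hs => (hFs s hs).abs_im_le) x
    have hpi : 0 < 2 / Real.pi := by positivity
    rw [smul_form, Complex.re_ofReal_mul, Complex.im_ofReal_mul, abs_mul, abs_of_pos hpi]
    have := mul_le_mul_of_nonneg_left h1 hpi.le
    linarith
  rw [geomMean_eq]
  refine ⟨hG.inv, fun x => ?_⟩
  have h1 := re_form_inv_le hf (by simpa using congrArg conjTranspose hRS) hGlow x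
  simp only [inv_inv] at h1
  rwa [wsq_const_mul] at h1

lemma weightedGeomMean_eq (t : ℝ) (A B : Matrix (Fin n) (Fin n) ℂ) :
    weightedGeomMean t A B = ((Real.sin (t * Real.pi) / Real.pi : ℝ) : ℂ) •
      matIntegral fun s => ((s ^ (t - 1) : ℝ) : ℂ) • (A⁻¹ + (s : ℂ) • B⁻¹)⁻¹ :=
  rfl

/-- The lower bound comes from the parallel sum and is free of constants. For the upper one,
inverting `A` and `B` costs `1 + c²` once, and inverting their combination costs nothing more. -/
lemma weightedGeomMean_bounds {t : ℝ} (ht₀ : 0 < t) (ht₁ : t < 1) (hc : 0 ≤ c)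
    (hA : IsSectorial c A) (hB : IsSectorial c B)
    (hRS : Rᴴ * S = 1) (hd : ∀ i, 0 < d i) (hA' : ∀ x, (form A x x).re = wsq 1 (S *ᵥ x))
    (hB' : ∀ x, (form B x x).re = wsq d (S *ᵥ x)) :
    IsSectorial c (weightedGeomMean t A B) ∧
      (∀ x, wsq (fun i => d i ^ t) (S *ᵥ x) ≤ (form (weightedGeomMean t A B) x x).re) ∧
      ∀ x, (form (weightedGeomMean t A B) x x).re ≤
        (1 + c ^ 2) * wsq (fun i => d i ^ t) (S *ᵥ x) := by
  have hSR : Sᴴ * R = 1 := by simpa using congrArg conjTranspose hRS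
  set T : ℝ → Matrix (Fin n) (Fin n) ℂ := fun s => A⁻¹ + (s : ℂ) • B⁻¹ with hT
  set F : ℝ → Matrix (Fin n) (Fin n) ℂ := fun s => ((s ^ (t - 1) : ℝ) : ℂ) • (T s)⁻¹ with hF
  have hTs : ∀ s > 0, IsSectorial c (T s) := fun s hs => hA.inv.add (hB.inv.smul hs)
  have hFs : ∀ s > 0, IsSectorial c (F s) := fun s hs =>
    (hTs s hs).inv.smul (Real.rpow_pos_of_pos hs _)
  have hTlow : ∀ s > 0, ∀ x,
      wsq (fun i => (1 + c ^ 2)⁻¹ * (1 + s / d i)) (R *ᵥ x) ≤ (form (T s) x x).re :=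
    fun s hs x => by
      have h1 := le_re_form_inv (f := 1) (fun _ => one_pos) hc hRS hA' hA.abs_im_le x
      have h2 := mul_le_mul_of_nonneg_left
        (le_re_form_inv hd hc hRS hB' hB.abs_im_le x) (le_of_lt hs)
      rw [hT, add_form, smul_form, Complex.add_re, Complex.re_ofReal_mul, wsq_const_mul]
      simp only [div_eq_mul_inv]
      rw [wsq_add, wsq_const_mul]
      simp only [Pi.one_apply, inv_one] at h1
      linarith
  have hup : ∀ s > 0, ∀ x, (form (F s) x x).re ≤
      wsq (fun i => (1 + c ^ 2) * (s ^ (t - 1) * (1 + s / d i)⁻¹)) (S *ᵥ x) := fun s hs x => by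
    have h1 := re_form_inv_le (fun i => by have := hd i; positivity) hSR (hTlow s hs) x
    simp only [mul_inv, inv_inv] at h1
    rw [wsq_const_mul] at h1
    rw [wsq_const_mul, wsq_const_mul, hF, smul_form, Complex.re_ofReal_mul]
    have := mul_le_mul_of_nonneg_left h1 (Real.rpow_pos_of_pos hs (t - 1)).le
    linarith
  have hlow : ∀ s > 0, ∀ x,
      wsq (fun i => s ^ (t - 1) * (1 + s / d i)⁻¹) (S *ᵥ x) ≤ (form (F s) x x).re :=
    fun s hs x => by
      rw [wsq_const_mul, hF, smul_form, Complex.re_ofReal_mul]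
      exact mul_le_mul_of_nonneg_left (le_re_form_parallel_sum hRS hd hA' hB' hs x)
        (Real.rpow_pos_of_pos hs (t - 1)).le
  have hφ := fun i => integrableOn_rpow_mul_inv_one_add_div ht₀ ht₁ (hd i)
  have hint : ∀ i j, IntegrableOn (fun s => F s i j) (Ioi 0) :=
    integrableOn_of_sectorial hc
      (aestronglyMeasurable_smul_inv
        (continuous_const.add (Complex.continuous_ofReal.smul continuous_const)).continuousOn
        (fun s hs => (hTs s hs).isUnit)
        (Complex.continuous_ofReal.comp_continuousOn
          (continuousOn_id.rpow_const fun s (hs : 0 < s) => Or.inl hs.ne')))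
      (fun s hs => (hFs s hs).re_pos) (fun s hs => (hFs s hs).abs_im_le)
      (fun i => (hφ i).const_mul (1 + c ^ 2)) hup
  have hsin := sin_mul_pi_pos ht₀ ht₁
  have hk : 0 < Real.sin (t * Real.pi) / Real.pi := by positivity
  have hlow' : ∀ x, wsq (fun i => d i ^ t) (S *ᵥ x) ≤ (form (weightedGeomMean t A B) x x).re :=
    fun x => by
      rw [weightedGeomMean_eq, smul_form, Complex.re_ofReal_mul]
      refine le_trans (le_of_eq ?_)
        (mul_le_mul_of_nonneg_left (wsq_le_re_form_matIntegral hint hφ hlow x) hk.le)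
      rw [← wsq_const_mul]
      congr 1
      ext i
      rw [integral_rpow_mul_inv_one_add_div ht₀ ht₁ (hd i)]
      field_simp
  refine ⟨⟨fun x hx => ?_, fun x => ?_⟩, hlow', fun x => ?_⟩
  · exact (wsq_pos (fun i => Real.rpow_pos_of_pos (hd i) t) (mulVec_ne_zero hRS hx)).trans_le
      (hlow' x)
  · have h1 := abs_im_form_matIntegral_le hint (fun s hs => (hFs s hs).abs_im_le) x
    rw [weightedGeomMean_eq, smul_form, Complex.re_ofReal_mul, Complex.im_ofReal_mul, abs_mul,
      abs_of_pos hk]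
    have := mul_le_mul_of_nonneg_left h1 hk.le
    linarith
  · rw [weightedGeomMean_eq, smul_form, Complex.re_ofReal_mul]
    refine (mul_le_mul_of_nonneg_left (re_form_matIntegral_le_wsq hint
      (fun i => (hφ i).const_mul (1 + c ^ 2)) hup x) hk.le).trans (le_of_eq ?_)
    rw [← wsq_const_mul, ← wsq_const_mul]
    congr 1
    ext i
    rw [integral_const_mul, integral_rpow_mul_inv_one_add_div ht₀ ht₁ (hd i)]
    field_simp

lemma heinzMean_bounds {t : ℝ} (ht₀ : 0 < t) (ht₁ : t < 1) (hc : 0 ≤ c)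
    (hA : IsSectorial c A) (hB : IsSectorial c B)
    (hRS : Rᴴ * S = 1) (hd : ∀ i, 0 < d i) (hA' : ∀ x, (form A x x).re = wsq 1 (S *ᵥ x))
    (hB' : ∀ x, (form B x x).re = wsq d (S *ᵥ x)) :
    IsSectorial c (heinzMean t A B) ∧
      (∀ x, wsq (fun i => 1 / 2 * (d i ^ t + d i ^ (1 - t))) (S *ᵥ x) ≤
        (form (heinzMean t A B) x x).re) ∧
      ∀ x, (form (heinzMean t A B) x x).re ≤
        (1 + c ^ 2) * wsq (fun i => 1 / 2 * (d i ^ t + d i ^ (1 - t))) (S *ᵥ x) := by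
  obtain ⟨s1, l1, u1⟩ := weightedGeomMean_bounds ht₀ ht₁ hc hA hB hRS hd hA' hB'
  obtain ⟨s2, l2, u2⟩ := weightedGeomMean_bounds (t := 1 - t) (by linarith) (by linarith) hc
    hA hB hRS hd hA' hB'
  have hhalf : heinzMean t A B = ((1 / 2 : ℝ) : ℂ) •
      (weightedGeomMean t A B + weightedGeomMean (1 - t) A B) := by
    rw [heinzMean]
    norm_num
  rw [hhalf]
  refine ⟨(s1.add s2).smul (by norm_num), fun x => ?_, fun x => ?_⟩
  · rw [smul_form, add_form, Complex.re_ofReal_mul, Complex.add_re, wsq_const_mul, wsq_add]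
    linarith [l1 x, l2 x]
  · rw [smul_form, add_form, Complex.re_ofReal_mul, Complex.add_re, wsq_const_mul, wsq_add]
    linarith [u1 x, u2 x]

lemma re_form_arithMean (hA' : ∀ x, (form A x x).re = wsq 1 (S *ᵥ x))
    (hB' : ∀ x, (form B x x).re = wsq d (S *ᵥ x)) (x : Fin n → ℂ) :
    (form (arithMean A B) x x).re = wsq (fun i => 1 / 2 + 1 / 2 * d i) (S *ᵥ x) := by
  rw [← re_form_smul_add_smul hA' hB', arithMean, smul_add]
  norm_num

/-! ### Scalar inequalities between means -/

lemma sqrt_le_half_rpow_add {d : ℝ} (hd : 0 < d) (t : ℝ) :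
    √d ≤ 1 / 2 * (d ^ t + d ^ (1 - t)) := by
  have h1 : √d ^ 2 = d ^ t * d ^ (1 - t) := by
    rw [Real.sq_sqrt hd.le, ← Real.rpow_add hd]; simp
  have h2 := Real.rpow_pos_of_pos hd t
  have h3 := Real.rpow_pos_of_pos hd (1 - t)
  refine abs_le_of_sq_le_sq' ?_ (by positivity) |>.2
  rw [h1]
  nlinarith [sq_nonneg (d ^ t - d ^ (1 - t))]

/-- Weighted AM-GM of `d` and `1` with exponents `t` and `1 - t`; the two bounds add up to `d + 1`.
-/
lemma half_rpow_add_le {d t : ℝ} (hd : 0 < d) (ht₀ : 0 < t) (ht₁ : t < 1) :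
    1 / 2 * (d ^ t + d ^ (1 - t)) ≤ 1 / 2 + 1 / 2 * d := by
  have key : ∀ u : ℝ, 0 ≤ u → u ≤ 1 → d ^ u ≤ u * d + (1 - u) := fun u h0 h1 => by
    have := Real.geom_mean_le_arith_mean2_weighted h0 (sub_nonneg.2 h1) hd.le zero_le_one
      (by ring)
    simpa using this
  have h1 := key t ht₀.le ht₁.le
  have h2 := key (1 - t) (by linarith) (by linarith)
  linarith

end QNumRadius

end

theorem mainTheorem9 (n : ℕ) (α : ℝ) (hα₀ : 0 ≤ α) (hα₁ : α < Real.pi / 2)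
    (A B : Matrix (Fin n) (Fin n) ℂ)
    (hA : A ∈ QNumRadius.sectorialMatrices n α) (hB : B ∈ QNumRadius.sectorialMatrices n α)
    (q : ℂ) (hq : ‖q‖ ≤ 1) (t : ℝ) (ht₀ : 0 < t) (ht₁ : t < 1) :
    ‖q‖ ^ 2 * Real.cos α ^ 4 * QNumRadius.qNumericalRadius q (QNumRadius.geomMean A B) ≤
        ‖q‖ * QNumRadius.qNumericalRadius q (QNumRadius.heinzMean t A B) ∧
      ‖q‖ * QNumRadius.qNumericalRadius q (QNumRadius.heinzMean t A B) ≤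
        (1 / Real.cos α) ^ 4 * QNumRadius.qNumericalRadius q (QNumRadius.arithMean A B) := by
  have hA1 := QNumRadius.isSectorial_of_mem hA
  have hB1 := QNumRadius.isSectorial_of_mem hB
  obtain ⟨S, R, d, hRS, hd, hA2, hB2⟩ :=
    QNumRadius.exists_simultaneous_diagonal hA1.re_pos hB1.re_pos
  have hc : 0 ≤ Real.tan α := Real.tan_nonneg_of_nonneg_of_le_pi_div_two hα₀ hα₁.le
  have hcos : 0 < Real.cos α :=
    Real.cos_pos_of_mem_Ioo ⟨by linarith [Real.pi_pos], hα₁⟩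
  have hsec : 1 + Real.tan α ^ 2 = (1 / Real.cos α) ^ 2 := by
    rw [one_div, inv_pow, ← Real.inv_one_add_tan_sq hcos.ne', inv_inv]
  obtain ⟨hG, hGu⟩ := QNumRadius.geomMean_bounds hc hA1 hB1 hRS hd hA2 hB2
  obtain ⟨hH, hHl, hHu⟩ := QNumRadius.heinzMean_bounds ht₀ ht₁ hc hA1 hB1 hRS hd hA2 hB2
  have h1 := QNumRadius.norm_mul_qNumericalRadius_le hc hq hG
    (Y := QNumRadius.heinzMean t A B) fun x =>
      (hGu x).trans (mul_le_mul_of_nonneg_left ((QNumRadius.wsq_mono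
        (fun i => QNumRadius.sqrt_le_half_rpow_add (hd i) t) _).trans (hHl x)) (by positivity))
  have h2 := QNumRadius.norm_mul_qNumericalRadius_le hc hq hH
    (Y := QNumRadius.arithMean A B) fun x => by
      rw [QNumRadius.re_form_arithMean hA2 hB2]
      exact (hHu x).trans (mul_le_mul_of_nonneg_left (QNumRadius.wsq_mono
        (fun i => QNumRadius.half_rpow_add_le (hd i) ht₀ ht₁) _) (by positivity))
  rw [hsec, ← pow_mul] at h1 h2
  refine ⟨?_, h2⟩
  -- Multiplying by `|q| cos⁴ α` cancels `sec⁴ α` and produces the second factor `|q|`.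
  have h3 := mul_le_mul_of_nonneg_left h1
    (by positivity : 0 ≤ ‖q‖ * Real.cos α ^ 4)
  have h4 : Real.cos α ^ 4 * (1 / Real.cos α) ^ (2 * 2) = 1 := by
    rw [one_div, inv_pow]
    exact mul_inv_cancel₀ (by positivity)
  calc _ = ‖q‖ * Real.cos α ^ 4 *
        (‖q‖ * QNumRadius.qNumericalRadius q (QNumRadius.geomMean A B)) := by ring
    _ ≤ _ := h3
    _ = ‖q‖ * (Real.cos α ^ 4 * (1 / Real.cos α) ^ (2 * 2)) *
        QNumRadius.qNumericalRadius q (QNumRadius.heinzMean t A B) := by ring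
    _ = _ := by rw [h4, mul_one]
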